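/- **Setting.** Consider autonomous problems $y'=f(y)$, $y(t_0)=y_0$, on $[t_0,t_F]$, $t_0<t_F$, with $f$ of class $C^\infty$ on an open set $U\subseteq\mathbb R^N$ containing the solution; let $J=f'(y_0)$. Put $\varphi_k(Z)=\sum_{i\ge 0}Z^i/(i+k)!$ and $\psi_j(Z)=\sum_{k=1}^{j}p_{j,k}\varphi_k(Z)$. For a matrix $A$ let $r(y)=f(y)-f(y_0)-A(y-y_0)$. A three-stage method with coefficients $(a,b,g,p)$ computes $$Y_1=y_0+a_{1,1}\psi_1(g_{1,1}hA)\,hf(y_0),\qquad Y_2=y_0+a_{2,1}\psi_1(g_{2,1}hA)\,hf(y_0)+a_{2,2}\psi_2(g_{2,2}hA)\,h\Delta^{(1)}r,$$ $$y_1=y_0+b_1\psi_1(g_{3,1}hA)\,hf(y_0)+b_2\psi_2(g_{3,2}hA)\,h\Delta^{(1)}r+b_3\psi_3(g_{3,3}hA)\,h\Delta^{(2)}r,$$ where $\Delta^{(1)}r=r(Y_1)-r(y_0)$, $\Delta^{(2)}r=r(Y_2)-2r(Y_1)+r(y_0)$. It is an EPIRK-$K$ method with Krylov dimension $M$ if $A=V(V^TJV)V^T$,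 where the columns of $V$ are an orthonormal basis of $\mathrm{span}\{f(y_0),Jf(y_0),\dots,J^{M-1}f(y_0)\}$. It has order $q$ if for every such problem and every $M\ge q$ one has $y_1-y(t_0+h)=O(h^{q+1})$ as $h\to0^+$. **Order conditions.** The nine TK order conditions are $e_1=\dots=e_9=0$ ($e_1$ of order $1$, $e_2$ of order $2$, $e_3,e_4$ of order $3$, $e_5,\dots,e_9$ of order $4$), where, with $P_2=6p_{2,1}+3p_{2,2}$, $P_3=6p_{3,1}+3p_{3,2}+p_{3,3}$, $$e_1=b_1p_{1,1}-1,\quad e_2=\tfrac12(b_1g_{3,1}p_{1,1}-1),\quad e_4=\tfrac16(b_1g_{3,1}^2p_{1,1}-1),\quad e_9=\tfrac1{24}(b_1g_{3,1}^3p_{1,1}-1),$$ $$e_3=\tfrac16\big(p_{1,1}^2[a_{1,1}^2b_2P_2+(a_{2,1}^2-2a_{1,1}^2)b_3P_3]-2\big),\qquad e_5=\tfrac1{12}\big(2p_{1,1}^3[a_{1,1}^3b_2P_2+(a_{2,1}^3-2a_{1,1}^3)b_3P_3]-3\big),$$ $$e_6=\tfrac1{24}\big(2p_{1,1}^2[a_{1,1}^2g_{1,1}b_2P_2+(a_{2,1}^2g_{2,1}-2a_{1,1}^2g_{1,1})b_3P_3]-3\big),\qquad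 e_7=\tfrac1{12}\big(a_{1,1}^2a_{2,2}b_3p_{1,1}^2(2p_{2,1}+p_{2,2})P_3-1\big),$$ $$e_8=\tfrac1{24}p_{1,1}^2\big(-2a_{1,1}^2a_{2,2}b_3(2p_{2,1}+p_{2,2})P_3+a_{1,1}^2b_2g_{3,2}(12p_{2,1}+4p_{2,2})+(a_{2,1}^2-2a_{1,1}^2)b_3g_{3,3}(12p_{3,1}+4p_{3,2}+p_{3,3})\big).$$ **Method.** For $\alpha>0$ let $$a=\begin{bmatrix}\alpha&0&0\\ \alpha&\tfrac34&0\end{bmatrix},\quad b=\big(\tfrac1\alpha,\tfrac{352}{729},\tfrac{64}{729}\big),\quad \widehat b=\big(\tfrac1\alpha,\tfrac{32}{81},0\big),\quad g=\begin{bmatrix}\tfrac34&0&0\\ \tfrac34&0&0\\ 1&\tfrac9{16}&\tfrac9{16}\end{bmatrix},\quad p=\begin{bmatrix}\alpha&0&0\\1&1&0\\1&1&0\end{bmatrix}.$$ **Claim.** 1. For $\alpha=\sqrt3/2$ the method with weights $b$ satisfies all nine TK order conditions and has order four; the embedded method with weights $\widehat b$ satisfies the order conditions of order at most three and has order three. 2.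 The printed fraction $\widetilde\alpha=\frac{692665874901013}{799821658665135}$ is a rounding of this value, $|\widetilde\alpha-\sqrt3/2|<10^{-30}$. For $\alpha=\widetilde\alpha$ (the printed rational coefficients) the order conditions hold up to rounding: $|e_i|<10^{-30}$ for $i=1,\dots,9$ with the weights $b$, and for $i=1,\dots,4$ with the weights $\widehat b$. These residuals are the B-series coefficients of the local error. That is, with $f$ and its derivatives evaluated at $y_0$, for the weights $b$ and every $M\ge4$, $$y_1-y(t_0+h)=h\,e_1f+h^2e_2Jf+h^3\big(\tfrac{e_3}2f''(f,f)+e_4J^2f\big)+h^4\big(\tfrac{e_5}6f'''(f,f,f)+e_6f''(f,Jf)+\tfrac{e_7}2Jf''(f,f)+\tfrac{e_8}2Af''(f,f)+e_9J^3f\big)+O(h^5)$$ as $h\to0^+$, and for the weights $\widehat b$ and every $M\ge3$ the same expansion holds through $h^3$ with remainder $O(h^4)$. -/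

import Mathlib

open Set Filter Topology
open scoped ContDiff

noncomputable section

namespace EPIRK

/-- The phase space `ℝ^N` with its Euclidean structure. -/
abbrev Vec (N : ℕ) : Type := EuclideanSpace ℝ (Fin N)

/-- `φ_k(Z) = ∑_{i ≥ 0} Z^i / (i + k)!` for a real `N × N` matrix `Z`, viewed as a linear map
(the series converges absolutely in operator norm). -/
def phi {N : ℕ} (k : ℕ) (Z : Vec N →L[ℝ] Vec N) : Vec N →L[ℝ] Vec N :=
  ∑' i : ℕ, (1 / ((i + k).factorial : ℝ)) • Z ^ i

/-- Coefficients of a three-stage EPIRK method. Rows and columns are numbered from `0`: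
`a i j`, `b j`, `g i j`, `p j k` stand for the usual
`a_{i+1,j+1}`, `b_{j+1}`, `g_{i+1,j+1}`, `p_{j+1,k+1}`. -/
structure Coeffs where
  a : Matrix (Fin 2) (Fin 3) ℝ
  b : Fin 3 → ℝ
  g : Matrix (Fin 3) (Fin 3) ℝ
  p : Matrix (Fin 3) (Fin 3) ℝ

namespace Coeffs

variable (c : Coeffs)

/-- `ψ_{j+1}(Z) = ∑_{k ≤ j} p_{j+1,k+1} φ_{k+1}(Z)`. -/
def psi {N : ℕ} (j : Fin 3) (Z : Vec N →L[ℝ] Vec N) : Vec N →L[ℝ] Vec N :=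
  ∑ k ∈ Finset.univ.filter (fun k : Fin 3 => k ≤ j), c.p j k • phi ((k : ℕ) + 1) Z

/-- The remainder `r(x) = f(x) - f(y) - A (x - y)` of the linearisation at the current value `y`
with the (approximate) Jacobian `A`. -/
def remainder {N : ℕ} (f : Vec N → Vec N) (A : Vec N →L[ℝ] Vec N) (y x : Vec N) : Vec N :=
  f x - f y - A (x - y)

/-- The first internal stage `Y₁`. -/
def stage₁ {N : ℕ} (f : Vec N → Vec N) (A : Vec N →L[ℝ] Vec N) (y : Vec N) (h : ℝ) : Vec N :=
  y + c.a 0 0 • c.psi 0 ((c.g 0 0 * h) • A) (h • f y)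

/-- The forward difference `Δ⁽¹⁾ r(y) = r(Y₁) - r(y)`. -/
def delta₁ {N : ℕ} (f : Vec N → Vec N) (A : Vec N →L[ℝ] Vec N) (y : Vec N) (h : ℝ) : Vec N :=
  remainder f A y (c.stage₁ f A y h) - remainder f A y y

/-- The second internal stage `Y₂`. -/
def stage₂ {N : ℕ} (f : Vec N → Vec N) (A : Vec N →L[ℝ] Vec N) (y : Vec N) (h : ℝ) : Vec N :=
  y + c.a 1 0 • c.psi 0 ((c.g 1 0 * h) • A) (h • f y)
    + c.a 1 1 • c.psi 1 ((c.g 1 1 * h) • A) (h • c.delta₁ f A y h)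

/-- The forward difference `Δ⁽²⁾ r(y) = (r(Y₂) - r(Y₁)) - (r(Y₁) - r(y))`. -/
def delta₂ {N : ℕ} (f : Vec N → Vec N) (A : Vec N →L[ℝ] Vec N) (y : Vec N) (h : ℝ) : Vec N :=
  (remainder f A y (c.stage₂ f A y h) - remainder f A y (c.stage₁ f A y h))
    - c.delta₁ f A y h

/-- One step of size `h` of the three-stage method from the value `y`, with the matrix `A` in the
role of the Jacobian. -/
def step {N : ℕ} (f : Vec N → Vec N) (A : Vec N →L[ℝ] Vec N) (y : Vec N) (h : ℝ) : Vec N :=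
  y + c.b 0 • c.psi 0 ((c.g 2 0 * h) • A) (h • f y)
    + c.b 1 • c.psi 1 ((c.g 2 1 * h) • A) (h • c.delta₁ f A y h)
    + c.b 2 • c.psi 2 ((c.g 2 2 * h) • A) (h • c.delta₂ f A y h)

end Coeffs

/-- The Krylov subspace `span {v, J v, …, J^(M-1) v}`. -/
def krylov {N : ℕ} (J : Vec N →L[ℝ] Vec N) (v : Vec N) (M : ℕ) : Submodule ℝ (Vec N) :=
  Submodule.span ℝ ((fun i : ℕ => (J ^ i) v) '' {i | i < M})

/-- The matrix `V H Vᵀ` with `H = Vᵀ J V`, where `V` has orthonormal columns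
(that is, `V` is a linear isometry `ℝ^m → ℝ^N`). -/
def projectedJacobian {N m : ℕ} (J : Vec N →L[ℝ] Vec N) (V : Vec m →ₗᵢ[ℝ] Vec N) :
    Vec N →L[ℝ] Vec N :=
  let W : Vec m →L[ℝ] Vec N := V.toContinuousLinearMap
  let H : Vec m →L[ℝ] Vec m := (ContinuousLinearMap.adjoint W).comp (J.comp W)
  W.comp (H.comp (ContinuousLinearMap.adjoint W))

/-- The EPIRK-`K` method with coefficients `c` has order (at least) `q`: for every smooth
autonomous initial value problem `y' = f(y)`, every Krylov dimension `M ≥ q` and every orthonormal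
basis `V` of the Krylov subspace generated by the exact Jacobian and the right-hand side at the
initial value, the local error of one step of size `h` is `O(h^(q+1))` as `h → 0⁺`.
The number `m` of basis vectors is the dimension of the Krylov subspace, so it is smaller than `M`
when the Arnoldi iteration breaks down. -/
def HasOrderK (c : Coeffs) (q : ℕ) : Prop :=
  ∀ (N : ℕ) (U : Set (Vec N)) (f : Vec N → Vec N), IsOpen U → ContDiffOn ℝ ∞ f U →
  ∀ (t₀ tF : ℝ) (y : ℝ → Vec N), t₀ < tF →
    (∀ t ∈ Icc t₀ tF, y t ∈ U ∧ HasDerivWithinAt y (f (y t)) (Icc t₀ tF) t) →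
  ∀ (M m : ℕ) (V : Vec m →ₗᵢ[ℝ] Vec N), q ≤ M →
    LinearMap.range V.toLinearMap = krylov (fderiv ℝ f (y t₀)) (f (y t₀)) M →
    (fun h : ℝ =>
        c.step f (projectedJacobian (fderiv ℝ f (y t₀)) V) (y t₀) h - y (t₀ + h))
      =O[𝓝[>] 0] (fun h : ℝ => h ^ (q + 1))

/-- The number of nodes of the nine `TK`-trees with at most four nodes. -/
def treeOrder : Fin 9 → ℕ := ![1, 2, 3, 3, 4, 4, 4, 4, 4]

/-- For each of the nine `TK`-trees with at most four nodes, the coefficient of the three-stage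
EPIRK-`K` solution minus the coefficient of the exact solution. -/
def orderResidual (c : Coeffs) : Fin 9 → ℝ :=
  let a11 := c.a 0 0
  let a21 := c.a 1 0
  let a22 := c.a 1 1
  let b1 := c.b 0
  let b2 := c.b 1
  let b3 := c.b 2
  let g11 := c.g 0 0
  let g21 := c.g 1 0
  let g31 := c.g 2 0
  let g32 := c.g 2 1
  let g33 := c.g 2 2
  let p11 := c.p 0 0
  let p21 := c.p 1 0
  let p22 := c.p 1 1
  let p31 := c.p 2 0
  let p32 := c.p 2 1
  let p33 := c.p 2 2
  ![b1 * p11 - 1,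
    1 / 2 * (b1 * g31 * p11 - 1),
    1 / 6 * (6 * a11 ^ 2 * b2 * p11 ^ 2 * p21 + 3 * a11 ^ 2 * b2 * p11 ^ 2 * p22
      - 12 * a11 ^ 2 * b3 * p11 ^ 2 * p31 - 6 * a11 ^ 2 * b3 * p11 ^ 2 * p32
      - 2 * a11 ^ 2 * b3 * p11 ^ 2 * p33 + 6 * a21 ^ 2 * b3 * p11 ^ 2 * p31
      + 3 * a21 ^ 2 * b3 * p11 ^ 2 * p32 + a21 ^ 2 * b3 * p11 ^ 2 * p33 - 2),
    1 / 6 * (b1 * g31 ^ 2 * p11 - 1),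
    1 / 12 * (12 * a11 ^ 3 * b2 * p11 ^ 3 * p21 + 6 * a11 ^ 3 * b2 * p11 ^ 3 * p22
      - 24 * a11 ^ 3 * b3 * p11 ^ 3 * p31 - 12 * a11 ^ 3 * b3 * p11 ^ 3 * p32
      - 4 * a11 ^ 3 * b3 * p11 ^ 3 * p33 + 12 * a21 ^ 3 * b3 * p11 ^ 3 * p31
      + 6 * a21 ^ 3 * b3 * p11 ^ 3 * p32 + 2 * a21 ^ 3 * b3 * p11 ^ 3 * p33 - 3),
    1 / 24 * (12 * a11 ^ 2 * b2 * g11 * p11 ^ 2 * p21 + 6 * a11 ^ 2 * b2 * g11 * p11 ^ 2 * p22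
      - 24 * a11 ^ 2 * b3 * g11 * p11 ^ 2 * p31 - 12 * a11 ^ 2 * b3 * g11 * p11 ^ 2 * p32
      - 4 * a11 ^ 2 * b3 * g11 * p11 ^ 2 * p33 + 12 * a21 ^ 2 * b3 * g21 * p11 ^ 2 * p31
      + 6 * a21 ^ 2 * b3 * g21 * p11 ^ 2 * p32 + 2 * a21 ^ 2 * b3 * g21 * p11 ^ 2 * p33 - 3),
    1 / 12 * (12 * a11 ^ 2 * a22 * b3 * p11 ^ 2 * p21 * p31
      + 6 * a11 ^ 2 * a22 * b3 * p11 ^ 2 * p21 * p32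
      + 2 * a11 ^ 2 * a22 * b3 * p11 ^ 2 * p21 * p33
      + 6 * a11 ^ 2 * a22 * b3 * p11 ^ 2 * p22 * p31
      + 3 * a11 ^ 2 * a22 * b3 * p11 ^ 2 * p22 * p32
      + a11 ^ 2 * a22 * b3 * p11 ^ 2 * p22 * p33 - 1),
    1 / 24 * p11 ^ 2 * (-24 * a11 ^ 2 * a22 * b3 * p21 * p31 - 12 * a11 ^ 2 * a22 * b3 * p21 * p32
      - 4 * a11 ^ 2 * a22 * b3 * p21 * p33 - 12 * a11 ^ 2 * a22 * b3 * p22 * p31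
      - 6 * a11 ^ 2 * a22 * b3 * p22 * p32 - 2 * a11 ^ 2 * a22 * b3 * p22 * p33
      + 12 * a11 ^ 2 * b2 * g32 * p21 + 4 * a11 ^ 2 * b2 * g32 * p22
      - 24 * a11 ^ 2 * b3 * g33 * p31 - 8 * a11 ^ 2 * b3 * g33 * p32
      - 2 * a11 ^ 2 * b3 * g33 * p33 + 12 * a21 ^ 2 * b3 * g33 * p31
      + 4 * a21 ^ 2 * b3 * g33 * p32 + a21 ^ 2 * b3 * g33 * p33),
    1 / 24 * (b1 * g31 ^ 3 * p11 - 1)]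

/-- All `TK` order conditions for trees with at most `q` nodes hold (here `q ≤ 4`). -/
def SatisfiesTK (c : Coeffs) (q : ℕ) : Prop :=
  ∀ i, treeOrder i ≤ q → orderResidual c i = 0

/-- The orders of the symmetry groups of the nine `TK`-trees. -/
def symmetry : Fin 9 → ℝ := ![1, 1, 2, 1, 6, 1, 2, 2, 1]

/-- The elementary differentials of the nine `TK`-trees at the point `y`; `A` is the approximate
Jacobian, which belongs to the fat vertex of the eighth tree. -/
def elementaryDifferential {N : ℕ} (f : Vec N → Vec N) (A : Vec N →L[ℝ] Vec N) (y : Vec N) :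
    Fin 9 → Vec N :=
  let J := fderiv ℝ f y
  let D2 := iteratedFDeriv ℝ 2 f y
  let D3 := iteratedFDeriv ℝ 3 f y
  ![f y,
    J (f y),
    D2 ![f y, f y],
    J (J (f y)),
    D3 ![f y, f y, f y],
    D2 ![f y, J (f y)],
    J (D2 ![f y, f y]),
    A (D2 ![f y, f y]),
    J (J (J (f y)))]

/-- The terms of the B-series of the local error (numerical minus exact solution) that belong to
the `TK`-trees with at most `q` nodes, when the difference of the coefficients is
`orderResidual c`. -/
def errorSeries (c : Coeffs) (q : ℕ) {N : ℕ} (f : Vec N → Vec N) (A : Vec N →L[ℝ] Vec N)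
    (y : Vec N) (h : ℝ) : Vec N :=
  ∑ i ∈ Finset.univ.filter (fun i : Fin 9 => treeOrder i ≤ q),
    (orderResidual c i * (h ^ treeOrder i / symmetry i)) • elementaryDifferential f A y i

/-- In the setting of `HasOrderK`, the local error of the EPIRK-`K` method agrees with the `TK`-tree
series truncated after order `q` up to `O(h^(q+1))` (here `q ≤ 4`). -/
def HasErrorExpansionK (c : Coeffs) (q : ℕ) : Prop :=
  ∀ (N : ℕ) (U : Set (Vec N)) (f : Vec N → Vec N), IsOpen U → ContDiffOn ℝ ∞ f U →
  ∀ (t₀ tF : ℝ) (y : ℝ → Vec N), t₀ < tF →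
    (∀ t ∈ Icc t₀ tF, y t ∈ U ∧ HasDerivWithinAt y (f (y t)) (Icc t₀ tF) t) →
  ∀ (M m : ℕ) (V : Vec m →ₗᵢ[ℝ] Vec N), q ≤ M →
    LinearMap.range V.toLinearMap = krylov (fderiv ℝ f (y t₀)) (f (y t₀)) M →
    (fun h : ℝ =>
        c.step f (projectedJacobian (fderiv ℝ f (y t₀)) V) (y t₀) h - y (t₀ + h)
          - errorSeries c q f (projectedJacobian (fderiv ℝ f (y t₀)) V) (y t₀) h)
      =O[𝓝[>] 0] (fun h : ℝ => h ^ (q + 1))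

/-- The coefficients of `epirkk4`, as a function of the number `α` that occurs in
`a_{11}, a_{21}, p_{11}` and, inverted, in `b_1`. -/
def epirkk4 (α : ℝ) : Coeffs where
  a := !![α, 0, 0; α, 3 / 4, 0]
  b := ![1 / α, 352 / 729, 64 / 729]
  g := !![3 / 4, 0, 0; 3 / 4, 0, 0; 1, 9 / 16, 9 / 16]
  p := !![α, 0, 0; 1, 1, 0; 1, 1, 0]

/-- The embedded method: the weights `b` are replaced by `b̂`. -/
def epirkk4Embedded (α : ℝ) : Coeffs :=
  { epirkk4 α with b := ![1 / α, 32 / 81, 0] }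

/-- The fraction by which `√3 / 2` is represented in the printed coefficients. -/
def printedAlpha : ℝ := 692665874901013 / 799821658665135

end EPIRK

end

/-! Both the numerical step and the exact solution are expanded in powers of `h` through `h ^ 4`,
with remainder `O(h ^ 5)`, over the same elementary differentials. Their difference is the B-series
with coefficients `orderResidual`, so vanishing residuals give the order.

The exact solution is handled by Picard bootstrapping: an increment known modulo `h ^ n` gives `f`
along it modulo `h ^ n`, and integration gains one power (`exact_increment_isBigO`). The method is
expanded from the inside out, with Taylor's formula for `f` and the exact tail formula for `φ_k`
(`step_isBigO`).

The Krylov projection `A` satisfies `A J^i f = J^(i+1) f` for `i + 1 < M`. Hence `M ≥ 3` already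
turns `A f` and `A J f` into exact Jacobian terms. The only remaining Krylov defect, `J^3 f - A J^2
f`, carries a factor `h ^ 4`; it vanishes when `M ≥ 4` and is absorbed in the remainder of a
third-order expansion (`local_error_krylov`). No such identity is available for `f''(f,f)`, so `A
f''(f,f)` keeps its own tree.

For the given coefficients every residual is `0` or a rational multiple of `α^4 - 9/16` or `α^6 -
27/64`. Both factors vanish at `α^2 = 3/4`; the printed fraction needs only exact rational
arithmetic. -/

namespace EPIRK
open Asymptotics

/-! ### Taylor expansion of `f` along a curve -/

section Taylor

variable {E F : Type*} [NormedAddCommGroup E] [NormedSpace ℝ E] [NormedAddCommGroup F]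
  [NormedSpace ℝ F]

theorem isBigO_pow_pow_of_le {l : Filter ℝ} (hl : l ≤ 𝓝 0) {m n : ℕ} (hmn : m ≤ n) :
    (fun h : ℝ => h ^ n) =O[l] fun h => h ^ m := by
  have h1 : ∀ᶠ h : ℝ in l, |h| ≤ 1 := by
    have : ∀ᶠ h : ℝ in 𝓝 0, |h| < 1 := by
      have := Metric.ball_mem_nhds (0 : ℝ) one_pos
      filter_upwards [this] with h hh
      simpa using hh
    exact (this.filter_mono hl).mono fun h hh => hh.le
  refine IsBigO.of_bound 1 (h1.mono fun h hh => ?_)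
  rw [one_mul, norm_pow, norm_pow]
  exact pow_le_pow_of_le_one (norm_nonneg _) hh hmn

/-- A function of the form `h ^ n • g h` with `g` bounded near `0` is `O(h ^ m)` for `m ≤ n`. -/
theorem isBigO_pow_smul {l : Filter ℝ} (hl : l ≤ 𝓝 0) {m n : ℕ} (hmn : m ≤ n) {g : ℝ → E}
    (hg : ContinuousAt g 0) : (fun h : ℝ => h ^ n • g h) =O[l] fun h => h ^ m := by
  have h2 : g =O[l] fun _ => (1 : ℝ) := (hg.isBigO_one ℝ).mono hl
  simpa using (isBigO_pow_pow_of_le hl hmn).smul h2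

theorem taylor_three_isBigO [CompleteSpace F] {f : E → F} {x : E} (hf : ContDiffAt ℝ 4 f x) :
    (fun d => f (x + d) - ∑ k ∈ Finset.range 4,
      ((k.factorial : ℝ)⁻¹ • iteratedFDeriv ℝ k f x fun _ => d)) =O[𝓝 0] fun d => ‖d‖ ^ 4 := by
  have hev : ∀ᶠ z in 𝓝 x, ContDiffAt ℝ 4 f z := hf.eventually (by simp)
  have hcont : ContinuousAt (iteratedFDeriv ℝ 4 f) x :=
    (hf.iteratedFDeriv_right (i := 4) (m := 0) (by simp)).continuousAt
  obtain ⟨C, hC⟩ : ∃ C, ∀ᶠ z in 𝓝 x, ‖iteratedFDeriv ℝ 4 f z‖ ≤ C :=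
    ⟨_, hcont.norm.eventually_le_const (lt_add_one _)⟩
  obtain ⟨ε, hε, hball⟩ := Metric.eventually_nhds_iff_ball.1 (hev.and hC)
  -- `6⁻¹` is the prefactor `1/3!` of the integral remainder, `(1 - t)^3` is bounded by `1`, and `C`
  -- bounds the fourth derivative near `x`.
  refine IsBigO.of_bound (C * 6⁻¹) ?_
  filter_upwards [Metric.ball_mem_nhds (0 : E) hε] with d hd
  have hmem : ∀ t ∈ Icc (0 : ℝ) 1, x + t • d ∈ Metric.ball x ε := by
    intro t ht
    simp only [Metric.mem_ball, dist_self_add_left, dist_zero_right] at hd ⊢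
    rw [norm_smul, Real.norm_of_nonneg ht.1]
    nlinarith [norm_nonneg d, ht.2]
  rw [map_add_eq_sum_add_integral_iteratedFDeriv (f := f) (x := x) (y := d) (n := 3)
    (fun t ht => by exact_mod_cast (hball _ (hmem t ht)).1)]
  rw [add_sub_cancel_left, norm_smul, norm_pow, norm_norm]
  have hI : ‖∫ t in (0 : ℝ)..1, (1 - t) ^ 3 • iteratedFDeriv ℝ (3 + 1) f (x + t • d) fun _ => d‖
      ≤ (C * ‖d‖ ^ 4) * |1 - 0| := by
    refine intervalIntegral.norm_integral_le_of_norm_le_const fun t ht => ?_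
    rw [uIoc_of_le zero_le_one] at ht
    have ht' : t ∈ Icc (0 : ℝ) 1 := ⟨ht.1.le, ht.2⟩
    rw [norm_smul, norm_pow, Real.norm_of_nonneg (by linarith [ht.2])]
    have h1 : (1 - t) ^ 3 ≤ 1 := pow_le_one₀ (by linarith [ht.2]) (by linarith [ht.1])
    have h2 : ‖iteratedFDeriv ℝ (3 + 1) f (x + t • d) fun _ => d‖ ≤ C * ‖d‖ ^ 4 := by
      refine ((iteratedFDeriv ℝ (3 + 1) f (x + t • d)).le_opNorm _).trans ?_
      simp only [Finset.prod_const, Finset.card_univ, Fintype.card_fin]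
      exact mul_le_mul_of_nonneg_right (hball _ (hmem t ht')).2 (by positivity)
    calc _ ≤ 1 * ‖iteratedFDeriv ℝ (3 + 1) f (x + t • d) fun _ => d‖ := by gcongr
      _ ≤ _ := by rwa [one_mul]
  have : ‖((Nat.factorial 3 : ℕ) : ℝ)⁻¹‖ = 6⁻¹ := by norm_num [Nat.factorial]
  rw [this]
  simp only [sub_zero, abs_one, mul_one] at hI
  nlinarith

/-- Exchanging one argument costs `O(h ^ k)`, while each of the other `n` arguments contributes a
factor `O(h)`. Higher derivatives may therefore be evaluated on shorter expansions of the curve. -/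
theorem multilinear_diag_sub_isBigO {l : Filter ℝ} {n k : ℕ}
    (T : ContinuousMultilinearMap ℝ (fun _ : Fin (n + 1) => E) F) {d p : ℝ → E}
    (hd : d =O[l] fun h => h) (hp : p =O[l] fun h => h) (hdp : (fun h => d h - p h) =O[l] (· ^ k)) :
    (fun h => (T fun _ => d h) - T fun _ => p h) =O[l] fun h => h ^ (n + k) := by
  obtain ⟨C₁, hC₁⟩ := hd.bound
  obtain ⟨C₂, hC₂⟩ := hp.bound
  obtain ⟨C₃, hC₃⟩ := hdp.bound
  refine IsBigO.of_bound (‖T‖ * (n + 1) * (max C₁ C₂) ^ n * C₃) ?_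
  filter_upwards [hC₁, hC₂, hC₃] with h h1 h2 h3
  refine (T.norm_image_sub_le _ _).trans ?_
  have e1 : ‖fun _ : Fin (n + 1) => d h‖ = ‖d h‖ := pi_norm_const _
  have e2 : ‖fun _ : Fin (n + 1) => p h‖ = ‖p h‖ := pi_norm_const _
  have e3 : ‖(fun _ : Fin (n + 1) => d h) - fun _ : Fin (n + 1) => p h‖ = ‖d h - p h‖ :=
    pi_norm_const (d h - p h)
  rw [e1, e2, e3]
  have hm : max ‖d h‖ ‖p h‖ ≤ max C₁ C₂ * ‖h‖ :=
    max_le (h1.trans (by gcongr; exact le_max_left _ _))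
      (h2.trans (by gcongr; exact le_max_right _ _))
  have hm0 : 0 ≤ max ‖d h‖ ‖p h‖ := (norm_nonneg _).trans (le_max_left _ _)
  have hm1 : 0 ≤ max C₁ C₂ * ‖h‖ := hm0.trans hm
  simp only [Fintype.card_fin, Nat.cast_add, Nat.cast_one, add_tsub_cancel_right]
  calc ‖T‖ * (n + 1) * max ‖d h‖ ‖p h‖ ^ n * ‖d h - p h‖
      ≤ ‖T‖ * (n + 1) * (max C₁ C₂ * ‖h‖) ^ n * (C₃ * ‖h ^ k‖) := by gcongr
    _ = _ := by rw [mul_pow, norm_pow, norm_pow]; ring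

omit [NormedSpace ℝ E] in
theorem isBigO_id_of_sub_isBigO {l : Filter ℝ} (hl : l ≤ 𝓝 0) {k : ℕ} (hk : 1 ≤ k)
    {d p : ℝ → E} (hp : p =O[l] fun h => h) (hdp : (fun h => d h - p h) =O[l] (· ^ k)) :
    d =O[l] fun h => h := by
  have := (hdp.trans (by simpa using isBigO_pow_pow_of_le hl hk)).add hp
  simpa using this

section Composition

variable [CompleteSpace F] {f : E → F} {x : E} {l : Filter ℝ} {d : ℝ → E}

theorem sub_taylor_isBigO_pow (hf : ContDiffAt ℝ 4 f x) (hl : l ≤ 𝓝 0)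
    (hd : d =O[l] fun h => h) :
    (fun h => f (x + d h) - f x - (fderiv ℝ f x (d h)
      + (2⁻¹ : ℝ) • (iteratedFDeriv ℝ 2 f x fun _ => d h)
      + (6⁻¹ : ℝ) • (iteratedFDeriv ℝ 3 f x fun _ => d h))) =O[l] fun h => h ^ 4 := by
  have hd0 : Tendsto d l (𝓝 0) := hd.trans_tendsto hl
  refine (((taylor_three_isBigO hf).comp_tendsto hd0).congr_left fun h => ?_).trans
    (hd.norm_left.pow 4)
  simp [Finset.sum_range_succ, Nat.factorial]
  abel

theorem comp_isBigO_two (hf : ContDiffAt ℝ 4 f x) (hl : l ≤ 𝓝 0) {u₁ : E}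
    (hd : (fun h => d h - h • u₁) =O[l] fun h => h ^ 2) :
    (fun h => f (x + d h) - f x - h • fderiv ℝ f x u₁) =O[l] fun h => h ^ 2 := by
  have hp : (fun h : ℝ => h • u₁) =O[l] fun h => h := by
    simpa using isBigO_pow_smul (m := 1) (n := 1) hl le_rfl (continuousAt_const (y := u₁))
  have hd1 := isBigO_id_of_sub_isBigO hl one_le_two hp hd
  have hz : (fun _ : ℝ => (0 : E)) =O[l] fun h : ℝ => h := isBigO_zero _ _
  have hd1' : (fun h => d h - 0) =O[l] fun h : ℝ => h ^ 1 := by simpa using hd1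
  have h0 := (sub_taylor_isBigO_pow hf hl hd1).trans (isBigO_pow_pow_of_le hl (by norm_num : 2 ≤ 4))
  have h1 := ((fderiv ℝ f x).isBigO_comp _ l).trans hd
  have h2 := multilinear_diag_sub_isBigO (iteratedFDeriv ℝ 2 f x) hd1 hz hd1'
  have h3 := (multilinear_diag_sub_isBigO (iteratedFDeriv ℝ 3 f x) hd1 hz hd1').trans
    (isBigO_pow_pow_of_le hl (by norm_num : 2 ≤ 3))
  refine (((h0.add h1).add (h2.const_smul_left (2⁻¹ : ℝ))).add
    (h3.const_smul_left (6⁻¹ : ℝ))).congr_left fun h => ?_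
  have e2 : (iteratedFDeriv ℝ 2 f x fun _ => (0 : E)) = 0 := (iteratedFDeriv ℝ 2 f x).map_zero
  have e3 : (iteratedFDeriv ℝ 3 f x fun _ => (0 : E)) = 0 := (iteratedFDeriv ℝ 3 f x).map_zero
  simp only [map_sub, map_smul, Pi.smul_apply, e2, e3, sub_zero]
  abel

theorem comp_isBigO_three (hf : ContDiffAt ℝ 4 f x) (hl : l ≤ 𝓝 0) {u₁ u₂ : E}
    (hd : (fun h => d h - (h • u₁ + h ^ 2 • u₂)) =O[l] fun h => h ^ 3) :
    (fun h => f (x + d h) - f x - (h • fderiv ℝ f x u₁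
      + h ^ 2 • (fderiv ℝ f x u₂ + (2⁻¹ : ℝ) • fderiv ℝ (fderiv ℝ f) x u₁ u₁)))
      =O[l] fun h => h ^ 3 := by
  have hp : (fun h : ℝ => h • u₁) =O[l] fun h => h := by
    simpa using isBigO_pow_smul (m := 1) (n := 1) hl le_rfl (continuousAt_const (y := u₁))
  have hd2 : (fun h => d h - h • u₁) =O[l] fun h => h ^ 2 := by
    refine ((hd.trans (isBigO_pow_pow_of_le hl (by norm_num : 2 ≤ 3))).add
      (isBigO_pow_smul hl le_rfl (continuousAt_const (y := u₂)))).congr_left fun h => ?_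
    abel
  have hd1 := isBigO_id_of_sub_isBigO hl one_le_two hp hd2
  have hz : (fun _ : ℝ => (0 : E)) =O[l] fun h : ℝ => h := isBigO_zero _ _
  have hd1' : (fun h => d h - 0) =O[l] fun h : ℝ => h ^ 1 := by simpa using hd1
  have h0 := (sub_taylor_isBigO_pow hf hl hd1).trans (isBigO_pow_pow_of_le hl (by norm_num : 3 ≤ 4))
  have h1 := ((fderiv ℝ f x).isBigO_comp _ l).trans hd
  have h2 := multilinear_diag_sub_isBigO (iteratedFDeriv ℝ 2 f x) hd1 hp hd2
  have h3 := multilinear_diag_sub_isBigO (iteratedFDeriv ℝ 3 f x) hd1 hz hd1'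
  refine (((h0.add h1).add (h2.const_smul_left (2⁻¹ : ℝ))).add
    (h3.const_smul_left (6⁻¹ : ℝ))).congr_left fun h => ?_
  have e2 : ∀ z, (iteratedFDeriv ℝ 2 f x fun _ => z) = fderiv ℝ (fderiv ℝ f) x z z :=
    fun z => iteratedFDeriv_two_apply f x _
  have e3 : (iteratedFDeriv ℝ 3 f x fun _ => (0 : E)) = 0 := (iteratedFDeriv ℝ 3 f x).map_zero
  simp only [map_sub, map_add, map_smul, Pi.smul_apply, e2, e3, sub_zero,
    _root_.smul_apply]
  module

/-- The linear term needs all of `u₁, u₂, u₃`, the quadratic term only `u₁, u₂`, and the cubic term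
only `u₁`; what is dropped is `O(h ^ 4)` in each case. -/
theorem comp_isBigO_four (hf : ContDiffAt ℝ 4 f x) (hl : l ≤ 𝓝 0) {u₁ u₂ u₃ : E}
    (hd : (fun h => d h - (h • u₁ + h ^ 2 • u₂ + h ^ 3 • u₃)) =O[l] fun h => h ^ 4) :
    (fun h => f (x + d h) - f x - (h • fderiv ℝ f x u₁
      + h ^ 2 • (fderiv ℝ f x u₂ + (2⁻¹ : ℝ) • fderiv ℝ (fderiv ℝ f) x u₁ u₁)
      + h ^ 3 • (fderiv ℝ f x u₃ + fderiv ℝ (fderiv ℝ f) x u₁ u₂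
        + (6⁻¹ : ℝ) • iteratedFDeriv ℝ 3 f x fun _ => u₁))) =O[l] fun h => h ^ 4 := by
  have hsymm : fderiv ℝ (fderiv ℝ f) x u₂ u₁ = fderiv ℝ (fderiv ℝ f) x u₁ u₂ :=
    hf.isSymmSndFDerivAt
      (by rw [minSmoothness_of_isRCLikeNormedField]; exact mod_cast (by norm_num : 2 ≤ 4)) u₂ u₁
  have hp : (fun h : ℝ => h • u₁) =O[l] fun h => h := by
    simpa using isBigO_pow_smul (m := 1) (n := 1) hl le_rfl (continuousAt_const (y := u₁))
  have hp2 : (fun h : ℝ => h • u₁ + h ^ 2 • u₂) =O[l] fun h => h :=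
    hp.add ((isBigO_pow_smul (m := 1) (n := 2) hl one_le_two
      (continuousAt_const (y := u₂))).trans (by simpa using isBigO_refl _ _))
  have hd3 : (fun h => d h - (h • u₁ + h ^ 2 • u₂)) =O[l] fun h => h ^ 3 := by
    refine ((hd.trans (isBigO_pow_pow_of_le hl (by norm_num : 3 ≤ 4))).add
      (isBigO_pow_smul hl le_rfl (continuousAt_const (y := u₃)))).congr_left fun h => ?_
    abel
  have hd2 : (fun h => d h - h • u₁) =O[l] fun h => h ^ 2 := by
    refine ((hd3.trans (isBigO_pow_pow_of_le hl (by norm_num : 2 ≤ 3))).add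
      (isBigO_pow_smul hl le_rfl (continuousAt_const (y := u₂)))).congr_left fun h => ?_
    abel
  have hd1 := isBigO_id_of_sub_isBigO hl one_le_two hp hd2
  have h0 := sub_taylor_isBigO_pow hf hl hd1
  have h1 := ((fderiv ℝ f x).isBigO_comp _ l).trans hd
  have h2 := multilinear_diag_sub_isBigO (iteratedFDeriv ℝ 2 f x) hd1 hp2 hd3
  have h3 := multilinear_diag_sub_isBigO (iteratedFDeriv ℝ 3 f x) hd1 hp hd2
  -- Squaring `h u₁ + h² u₂` leaves the surplus term `h⁴ f''(u₂,u₂)/2`.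
  have h4 := isBigO_pow_smul hl le_rfl (m := 4)
    (continuousAt_const (y := (2⁻¹ : ℝ) • fderiv ℝ (fderiv ℝ f) x u₂ u₂))
  refine ((((h0.add h1).add (h2.const_smul_left (2⁻¹ : ℝ))).add
    (h3.const_smul_left (6⁻¹ : ℝ))).add h4).congr_left fun h => ?_
  have e2 : ∀ z, (iteratedFDeriv ℝ 2 f x fun _ => z) = fderiv ℝ (fderiv ℝ f) x z z :=
    fun z => iteratedFDeriv_two_apply f x _
  have e3 : (iteratedFDeriv ℝ 3 f x fun _ => h • u₁)
      = h ^ 3 • iteratedFDeriv ℝ 3 f x fun _ => u₁ := by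
    simpa using (iteratedFDeriv ℝ 3 f x).map_smul_univ (fun _ => h) fun _ => u₁
  simp only [map_sub, map_add, map_smul, Pi.smul_apply, e2, e3,
    _root_.smul_apply, _root_.add_apply, hsymm]
  module

end Composition

end Taylor

/-! ### Expansion of the exact solution -/

section ExactSolution

variable {E : Type*} [NormedAddCommGroup E] [NormedSpace ℝ E]

theorem isBigO_pow_succ_of_hasDerivWithinAt {g g' : ℝ → E} {T : ℝ} (hT : 0 < T)
    (hg : ∀ t ∈ Icc 0 T, HasDerivWithinAt g (g' t) (Icc 0 T) t) (hg0 : g 0 = 0) {n : ℕ}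
    (hg' : g' =O[𝓝[≥] 0] fun h => h ^ n) : g =O[𝓝[≥] 0] fun h => h ^ (n + 1) := by
  obtain ⟨C, hC0, hC⟩ := hg'.exists_nonneg
  have hC := hC.bound
  have hT' : ∀ᶠ t : ℝ in 𝓝[≥] 0, t < T := mem_nhdsWithin_of_mem_nhds (Iio_mem_nhds hT)
  obtain ⟨ε, hε, hsub⟩ := mem_nhdsGE_iff_exists_Ico_subset.1 (hC.and hT')
  refine IsBigO.of_bound C ?_
  filter_upwards [Ico_mem_nhdsGE hε] with h hh
  have hIcc : Icc 0 h ⊆ Icc 0 T := Icc_subset_Icc_right (hsub hh).2.le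
  have hbound : ∀ t ∈ Icc 0 h, ‖g' t‖ ≤ C * h ^ n := fun t ht => by
    refine (hsub ⟨ht.1, ht.2.trans_lt hh.2⟩).1.trans ?_
    rw [norm_pow, Real.norm_of_nonneg ht.1]
    exact mul_le_mul_of_nonneg_left (pow_le_pow_left₀ ht.1 ht.2 n) hC0
  have := Convex.norm_image_sub_le_of_norm_hasDerivWithin_le
    (fun t ht => (hg t (hIcc ht)).mono hIcc) hbound (convex_Icc 0 h) (left_mem_Icc.2 hh.1)
    (right_mem_Icc.2 hh.1)
  rw [hg0, sub_zero, sub_zero] at this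
  rwa [norm_pow, pow_succ, ← mul_assoc, Real.norm_of_nonneg hh.1] at *

theorem hasDerivWithinAt_pow_smul (n : ℕ) (a : E) (s : Set ℝ) (t : ℝ) :
    HasDerivWithinAt (fun h : ℝ => h ^ n • a) ((n * t ^ (n - 1)) • a) s t :=
  ((hasDerivAt_pow n t).smul_const a).hasDerivWithinAt

variable [CompleteSpace E] {f : E → E} {x : E} {d : ℝ → E} {T : ℝ}

/-- The Taylor expansion of the increment `d` of a solution of `y' = f(y)` starting at `x`. -/
theorem exact_increment_isBigO (hf : ContDiffAt ℝ 4 f x) (hT : 0 < T)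
    (hd : ∀ t ∈ Icc 0 T, HasDerivWithinAt d (f (x + d t)) (Icc 0 T) t) (hd0 : d 0 = 0) :
    (fun h => d h - (h • f x + h ^ 2 • (2⁻¹ : ℝ) • fderiv ℝ f x (f x)
      + h ^ 3 • (6⁻¹ : ℝ) • (fderiv ℝ f x (fderiv ℝ f x (f x))
        + fderiv ℝ (fderiv ℝ f) x (f x) (f x))
      + h ^ 4 • (24⁻¹ : ℝ) • (fderiv ℝ f x (fderiv ℝ f x (fderiv ℝ f x (f x)))
        + fderiv ℝ f x (fderiv ℝ (fderiv ℝ f) x (f x) (f x))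
        + (3 : ℝ) • fderiv ℝ (fderiv ℝ f) x (f x) (fderiv ℝ f x (f x))
        + iteratedFDeriv ℝ 3 f x fun _ => f x))) =O[𝓝[≥] 0] fun h => h ^ 5 := by
  have hl : 𝓝[≥] (0 : ℝ) ≤ 𝓝 0 := nhdsWithin_le_nhds
  have hmem : (0 : ℝ) ∈ Icc 0 T := left_mem_Icc.2 hT.le
  have hcont : Tendsto d (𝓝[≥] 0) (𝓝 0) := by
    have := (hd 0 hmem).continuousWithinAt.tendsto
    rwa [hd0, nhdsWithin_Icc_eq_nhdsGE hT] at this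
  -- One Picard step: if `p'` matches the right-hand side modulo `h ^ n`, then `p` matches `d`
  -- modulo `h ^ (n + 1)`. It is applied five times, starting from mere continuity (`n = 0`). The
  -- filter is one-sided because the solution is given only to the right of `0`.
  have key : ∀ (p : ℝ → E) (p' : ℝ → E) (n : ℕ), p 0 = 0 →
      (∀ t, HasDerivWithinAt p (p' t) (Icc 0 T) t) →
      (fun h => f (x + d h) - p' h) =O[𝓝[≥] 0] (fun h => h ^ n) →
      (fun h => d h - p h) =O[𝓝[≥] 0] fun h => h ^ (n + 1) := fun p p' n hp0 hp h =>
    isBigO_pow_succ_of_hasDerivWithinAt hT (fun t ht => (hd t ht).sub (hp t))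
      (by simp [hd0, hp0]) h
  have h1 : (fun h => d h - 0) =O[𝓝[≥] 0] fun h : ℝ => h ^ (0 + 1) := by
    refine key (fun _ => 0) (fun _ => 0) 0 rfl (fun t => hasDerivWithinAt_const _ _ _) ?_
    have : Tendsto (fun h => f (x + d h)) (𝓝[≥] 0) (𝓝 (f x)) := by
      refine hf.continuousAt.tendsto.comp ?_
      simpa using hcont.const_add x
    simpa using this.isBigO_one ℝ
  have h1' : d =O[𝓝[≥] 0] fun h : ℝ => h := by simpa using h1
  have h2 : (fun h => d h - h • f x) =O[𝓝[≥] 0] fun h => h ^ (1 + 1) := by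
    refine key (fun h => h • f x) (fun _ => f x) 1 (by simp)
      (fun t => by simpa using hasDerivWithinAt_pow_smul 1 (f x) (Icc 0 T) t) ?_
    have hdiff := (hf.differentiableAt (by simp)).hasFDerivAt.isBigO_sub
    have htend : Tendsto (fun h => x + d h) (𝓝[≥] 0) (𝓝 x) := by simpa using hcont.const_add x
    refine ((hdiff.comp_tendsto htend).congr_left fun h => rfl).trans ?_
    simpa [Function.comp_def] using h1'
  have h3 := key (fun h => h • f x + h ^ 2 • (2⁻¹ : ℝ) • fderiv ℝ f x (f x))
    (fun h => f x + h • fderiv ℝ f x (f x)) 2 (by simp)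
    (fun t => by
      convert (hasDerivWithinAt_pow_smul 1 (f x) (Icc 0 T) t).add
        (hasDerivWithinAt_pow_smul 2 ((2⁻¹ : ℝ) • fderiv ℝ f x (f x)) (Icc 0 T) t) using 1
      · ext h; simp
      · simp; module)
    ((comp_isBigO_two hf hl h2).congr_left fun h => by abel)
  have h4 := key (fun h => h • f x + h ^ 2 • (2⁻¹ : ℝ) • fderiv ℝ f x (f x)
      + h ^ 3 • (6⁻¹ : ℝ) • (fderiv ℝ f x (fderiv ℝ f x (f x))
        + fderiv ℝ (fderiv ℝ f) x (f x) (f x)))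
    (fun h => f x + (h • fderiv ℝ f x (f x) + h ^ 2 • (fderiv ℝ f x ((2⁻¹ : ℝ) • fderiv ℝ f x (f x))
      + (2⁻¹ : ℝ) • fderiv ℝ (fderiv ℝ f) x (f x) (f x)))) 3 (by simp)
    (fun t => by
      convert ((hasDerivWithinAt_pow_smul 1 (f x) (Icc 0 T) t).add
        (hasDerivWithinAt_pow_smul 2 ((2⁻¹ : ℝ) • fderiv ℝ f x (f x)) (Icc 0 T) t)).add
        (hasDerivWithinAt_pow_smul 3 ((6⁻¹ : ℝ) • (fderiv ℝ f x (fderiv ℝ f x (f x))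
        + fderiv ℝ (fderiv ℝ f) x (f x) (f x))) (Icc 0 T) t) using 1
      · ext h; simp
      · simp only [map_smul]; push_cast; norm_num only [pow_one, pow_zero]; module)
    ((comp_isBigO_three hf hl h3).congr_left fun h => by abel)
  refine key _ _ 4 (by simp) (fun t => ?_)
    ((comp_isBigO_four hf hl h4).congr_left fun h => sub_sub _ _ _)
  convert (((hasDerivWithinAt_pow_smul 1 (f x) (Icc 0 T) t).add
        (hasDerivWithinAt_pow_smul 2 ((2⁻¹ : ℝ) • fderiv ℝ f x (f x)) (Icc 0 T) t)).add
        (hasDerivWithinAt_pow_smul 3 ((6⁻¹ : ℝ) • (fderiv ℝ f x (fderiv ℝ f x (f x))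
        + fderiv ℝ (fderiv ℝ f) x (f x) (f x))) (Icc 0 T) t)).add
        (hasDerivWithinAt_pow_smul 4 ((24⁻¹ : ℝ) •
          (fderiv ℝ f x (fderiv ℝ f x (fderiv ℝ f x (f x)))
        + fderiv ℝ f x (fderiv ℝ (fderiv ℝ f) x (f x) (f x))
        + (3 : ℝ) • fderiv ℝ (fderiv ℝ f) x (f x) (fderiv ℝ f x (f x))
        + iteratedFDeriv ℝ 3 f x fun _ => f x)) (Icc 0 T) t) using 1
  · ext h; simp
  · simp only [map_smul, map_add]; push_cast; norm_num only [pow_one, pow_zero]; module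

end ExactSolution

/-! ### Expansion of `φ_k` and `ψ_j` at small matrices -/

section Phi

variable {N : ℕ}

theorem clm_mul_smul (a : ℝ) (Z W : Vec N →L[ℝ] Vec N) : Z * (a • W) = a • (Z * W) := by
  ext1 v
  simp

theorem clm_smul_pow (a : ℝ) (Z : Vec N →L[ℝ] Vec N) (n : ℕ) : (a • Z) ^ n = a ^ n • Z ^ n := by
  induction n with
  | zero => simp
  | succ n ih =>
    ext1 v
    simp [pow_succ, ih, smul_smul, mul_comm]

theorem norm_phi_term_le (k i : ℕ) (Z : Vec N →L[ℝ] Vec N) :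
    ‖(1 / ((i + k).factorial : ℝ)) • Z ^ i‖ ≤ ‖Z‖ ^ i / i.factorial := by
  have hZ : ‖Z ^ i‖ ≤ ‖Z‖ ^ i := by
    -- For `N = 0` the identity has norm `0`, not `1`; only the bound by `1` holds for every `N`.
    rcases i.eq_zero_or_pos with rfl | hi
    · rw [pow_zero, pow_zero]; exact ContinuousLinearMap.norm_id_le
    · exact norm_pow_le' Z hi
  rw [norm_smul, Real.norm_of_nonneg (by positivity), one_div_mul_eq_div]
  have : (i.factorial : ℝ) ≤ (i + k).factorial := by
    exact_mod_cast Nat.factorial_le (Nat.le_add_right i k)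
  gcongr

theorem summable_phi (k : ℕ) (Z : Vec N →L[ℝ] Vec N) :
    Summable fun i : ℕ => (1 / ((i + k).factorial : ℝ)) • Z ^ i :=
  Summable.of_norm_bounded (Real.summable_pow_div_factorial ‖Z‖) (norm_phi_term_le k · Z)

theorem norm_phi_le (k : ℕ) (Z : Vec N →L[ℝ] Vec N) : ‖phi k Z‖ ≤ Real.exp ‖Z‖ := by
  rw [Real.exp_eq_exp_ℝ, NormedSpace.exp_eq_tsum_div]
  exact tsum_of_norm_bounded (Real.summable_pow_div_factorial ‖Z‖).hasSum (norm_phi_term_le k · Z)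

/-- Shifting the summation index identifies the tail as a power of `Z` times another `φ` function.
As every `φ` is bounded by the exponential of the norm, the truncation error is of the order of `Z ^
n`. -/
theorem phi_eq_sum_add (k n : ℕ) (Z : Vec N →L[ℝ] Vec N) :
    phi k Z = ∑ i ∈ Finset.range n, (1 / ((i + k).factorial : ℝ)) • Z ^ i
      + Z ^ n * phi (n + k) Z := by
  rw [phi, ← (summable_phi k Z).sum_add_tsum_nat_add n, phi,
    ← (summable_phi (n + k) Z).tsum_mul_left]
  congr 2
  ext1 i
  rw [clm_mul_smul, ← pow_add, add_comm n i, add_assoc]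

theorem phi_sub_sum_isBigO (k : ℕ) (r : ℝ) (A : Vec N →L[ℝ] Vec N) :
    (fun h : ℝ => phi k ((r * h) • A)
      - ∑ i ∈ Finset.range 4, (1 / ((i + k).factorial : ℝ)) • ((r * h) • A) ^ i)
      =O[𝓝 0] fun h => h ^ 4 := by
  have h1 : (fun h : ℝ => phi (4 + k) ((r * h) • A)) =O[𝓝 0] fun _ => (1 : ℝ) := by
    refine (IsBigO.of_bound 1 (Eventually.of_forall fun h => ?_)).trans
      ((Continuous.continuousAt (f := fun h : ℝ => Real.exp ‖(r * h) • A‖)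
        (by fun_prop)).isBigO_one ℝ)
    simpa using norm_phi_le (4 + k) ((r * h) • A)
  have h2 : (fun h : ℝ => ((r * h) • A) ^ 4) =O[𝓝 0] fun h => h ^ 4 := by
    refine (isBigO_pow_smul le_rfl (le_refl 4) (continuousAt_const (y := r ^ 4 • A ^ 4))).congr_left
      fun h => ?_
    rw [clm_smul_pow, mul_pow, smul_smul, mul_comm]
  refine (h2.mul h1).congr (fun h => ?_) (fun h => mul_one _)
  rw [phi_eq_sum_add k 4, add_sub_cancel_left]

/-- The `i`-th Taylor coefficient of `ψ_{j+1}`. -/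
noncomputable def Coeffs.psiCoeff (c : Coeffs) (j : Fin 3) (i : ℕ) : ℝ :=
  ∑ k ∈ Finset.univ.filter (fun k : Fin 3 => k ≤ j),
    c.p j k * (1 / ((i + ((k : ℕ) + 1)).factorial : ℝ))

theorem psi_sub_isBigO (c : Coeffs) (j : Fin 3) (r : ℝ) (A : Vec N →L[ℝ] Vec N) :
    (fun h : ℝ => c.psi j ((r * h) • A)
      - ∑ i ∈ Finset.range 4, c.psiCoeff j i • ((r * h) • A) ^ i) =O[𝓝 0] fun h => h ^ 4 := by
  refine (IsBigO.sum (s := Finset.univ.filter (fun k : Fin 3 => k ≤ j)) fun k _ =>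
    (phi_sub_sum_isBigO ((k : ℕ) + 1) r A).const_smul_left (c.p j k)).congr_left fun h => ?_
  simp only [Coeffs.psi, Coeffs.psiCoeff, Finset.sum_apply, Pi.smul_apply, smul_sub, Finset.sum_sub_distrib,
    Finset.smul_sum, smul_smul]
  rw [Finset.sum_comm]
  congr 1
  exact Finset.sum_congr rfl fun i _ => Finset.sum_smul.symm

theorem isBigO_clm_apply {E F : Type*} [NormedAddCommGroup E] [NormedSpace ℝ E]
    [NormedAddCommGroup F] [NormedSpace ℝ F] {l : Filter ℝ} {R : ℝ → E →L[ℝ] F} {G : ℝ → E}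
    {a b : ℝ → ℝ} (hR : R =O[l] a) (hG : G =O[l] b) :
    (fun h => R h (G h)) =O[l] fun h => a h * b h :=
  (IsBigO.of_bound 1 (Eventually.of_forall fun h => by
    simpa using (R h).le_opNorm (G h))).trans (hR.norm_left.mul hG.norm_left)

theorem psi_apply_const_isBigO (c : Coeffs) (j : Fin 3) (r : ℝ) (A : Vec N →L[ℝ] Vec N)
    (v : Vec N) {l : Filter ℝ} (hl : l ≤ 𝓝 0) :
    (fun h : ℝ => c.psi j ((r * h) • A) (h • v) - (h • c.psiCoeff j 0 • v
      + h ^ 2 • (c.psiCoeff j 1 * r) • A v + h ^ 3 • (c.psiCoeff j 2 * r ^ 2) • A (A v)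
      + h ^ 4 • (c.psiCoeff j 3 * r ^ 3) • A (A (A v)))) =O[l] fun h => h ^ 5 := by
  have hv : (fun h : ℝ => h • v) =O[l] fun h => h ^ 1 := by
    simpa using isBigO_pow_smul hl (le_refl 1) (continuousAt_const (y := v))
  refine (isBigO_clm_apply ((psi_sub_isBigO c j r A).mono hl) hv).congr (fun h => ?_)
    fun h => by ring
  simp only [Finset.sum_range_succ, Finset.sum_range_zero, sub_apply, add_apply, smul_apply, zero_apply,
    clm_smul_pow, pow_succ, pow_zero, mul_apply_eq_comp, map_smul, one_apply_eq_self]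
  module

/-- By linearity the polynomial part of `G` is treated one coefficient at a time; on the rest of `G`
boundedness of `ψ_j` suffices. The form of `hG` is the one in which the forward differences are
expanded below. -/
theorem psi_apply_isBigO (c : Coeffs) (j : Fin 3) (r : ℝ) (A : Vec N →L[ℝ] Vec N)
    {u₁ u₂ u₃ : Vec N} {G : ℝ → Vec N} {l : Filter ℝ} (hl : l ≤ 𝓝 0)
    (hG : (fun h : ℝ => G h - (h • u₁ + h ^ 2 • u₂ + h ^ 3 • u₃)) =O[l] fun h => h ^ 4) :
    (fun h : ℝ => c.psi j ((r * h) • A) (h • G h) - (h ^ 2 • c.psiCoeff j 0 • u₁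
      + h ^ 3 • (c.psiCoeff j 0 • u₂ + (c.psiCoeff j 1 * r) • A u₁)
      + h ^ 4 • (c.psiCoeff j 0 • u₃ + (c.psiCoeff j 1 * r) • A u₂
        + (c.psiCoeff j 2 * r ^ 2) • A (A u₁)))) =O[l] fun h => h ^ 5 := by
  have hrest : (fun h : ℝ => h • (G h - (h • u₁ + h ^ 2 • u₂ + h ^ 3 • u₃))) =O[l]
      fun h => h ^ 5 :=
    ((isBigO_refl (fun h : ℝ => h) l).smul hG).congr_right fun h => by
      rw [smul_eq_mul]; ring
  have hpoly : ContinuousAt (fun h : ℝ => ∑ i ∈ Finset.range 4, c.psiCoeff j i • ((r * h) • A) ^ i)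
      0 := by
    refine Continuous.continuousAt ?_
    fun_prop
  have hpsi : (fun h : ℝ => c.psi j ((r * h) • A)) =O[l] fun _ => (1 : ℝ) := by
    refine ((((psi_sub_isBigO c j r A).mono hl).trans
      (isBigO_pow_pow_of_le hl (Nat.zero_le 4))).add
      (((hpoly.isBigO_one ℝ).mono hl).congr_right fun h => (pow_zero h).symm)).congr
      (fun h => by abel) fun h => pow_zero h
  have h0 := (isBigO_clm_apply hpsi hrest).congr_right fun h => one_mul _
  have e : ∀ m, (fun h : ℝ => h ^ (m + 1) * h ^ 5) =O[l] fun h => h ^ 5 := fun m =>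
    (isBigO_pow_pow_of_le hl (by omega : 5 ≤ m + 1 + 5)).congr_left fun h => by ring
  have h1 := ((isBigO_refl (fun h : ℝ => h ^ 1) l).smul (psi_apply_const_isBigO c j r A u₁ hl)).trans
    (e 0)
  have h2 := ((isBigO_refl (fun h : ℝ => h ^ 2) l).smul (psi_apply_const_isBigO c j r A u₂ hl)).trans
    (e 1)
  have h3 := ((isBigO_refl (fun h : ℝ => h ^ 3) l).smul (psi_apply_const_isBigO c j r A u₃ hl)).trans
    (e 2)
  -- All products of Taylor coefficients of total degree at least five.
  have h4 : (fun h : ℝ => h ^ 5 • ((c.psiCoeff j 3 * r ^ 3) • A (A (A u₁))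
      + (c.psiCoeff j 2 * r ^ 2) • A (A u₂) + (c.psiCoeff j 1 * r) • A u₃
      + h • ((c.psiCoeff j 3 * r ^ 3) • A (A (A u₂)) + (c.psiCoeff j 2 * r ^ 2) • A (A u₃))
      + h ^ 2 • (c.psiCoeff j 3 * r ^ 3) • A (A (A u₃)))) =O[l] fun h => h ^ 5 :=
    isBigO_pow_smul hl le_rfl (Continuous.continuousAt (by fun_prop))
  refine ((((h0.add h1).add h2).add h3).add h4).congr_left fun h => ?_
  simp only [map_sub, map_add, map_smul]
  module

end Phi

/-! ### The projected Jacobian on the Krylov space -/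

section Krylov

variable {N m : ℕ}

theorem pow_apply_mem_krylov (J : Vec N →L[ℝ] Vec N) (v : Vec N) {i M : ℕ} (hi : i < M) :
    (J ^ i) v ∈ krylov J v M :=
  Submodule.subset_span ⟨i, hi, rfl⟩

/-- `V Vᵀ` fixes the range of `V`; in `V Vᵀ J V Vᵀ w` it fixes first `w` and then `J w`. -/
theorem projectedJacobian_apply_of_mem (J : Vec N →L[ℝ] Vec N) (V : Vec m →ₗᵢ[ℝ] Vec N)
    {w : Vec N} (hw : w ∈ LinearMap.range V.toLinearMap)
    (hJw : J w ∈ LinearMap.range V.toLinearMap) : projectedJacobian J V w = J w := by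
  have hadj : ∀ z, (ContinuousLinearMap.adjoint V.toContinuousLinearMap) (V z) = z := fun z => by
    refine ext_inner_left ℝ fun u => ?_
    rw [ContinuousLinearMap.adjoint_inner_right]
    exact V.inner_map_map u z
  obtain ⟨z, rfl⟩ := hw
  obtain ⟨z', hz'⟩ := hJw
  change V z' = J (V z) at hz'
  change V ((ContinuousLinearMap.adjoint V.toContinuousLinearMap) (J (V
    ((ContinuousLinearMap.adjoint V.toContinuousLinearMap) (V z))))) = J (V z)
  rw [hadj, ← hz', hadj]

theorem projectedJacobian_apply_pow (J : Vec N →L[ℝ] Vec N) (V : Vec m →ₗᵢ[ℝ] Vec N) {v : Vec N}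
    {i M : ℕ} (hV : LinearMap.range V.toLinearMap = krylov J v M) (hi : i + 1 < M) :
    projectedJacobian J V ((J ^ i) v) = (J ^ (i + 1)) v := by
  have h : J ((J ^ i) v) = (J ^ (i + 1)) v := by rw [pow_succ', mul_apply_eq_comp]
  rw [← h]
  refine projectedJacobian_apply_of_mem J V ?_ ?_
  · rw [hV]; exact pow_apply_mem_krylov J v (by omega)
  · rw [hV, h]; exact pow_apply_mem_krylov J v hi

end Krylov

/-! ### Expansion of the stages and of the step -/

section Step

variable {N : ℕ} {f : Vec N → Vec N} {A : Vec N →L[ℝ] Vec N} {x : Vec N}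
  {l : Filter ℝ}

theorem remainder_self : Coeffs.remainder f A x x = 0 := by simp [Coeffs.remainder]

/-- Expansion of the remainder along a curve whose first two Taylor coefficients lie where `A`
agrees with the Jacobian. -/
theorem remainder_isBigO (hf : ContDiffAt ℝ 4 f x) (hl : l ≤ 𝓝 0)
    (hA₁ : A (f x) = fderiv ℝ f x (f x))
    (hA₂ : A (fderiv ℝ f x (f x)) = fderiv ℝ f x (fderiv ℝ f x (f x)))
    {Y : ℝ → Vec N} {s t : ℝ} {u : Vec N}
    (hY : (fun h => Y h - x - (h • s • f x + h ^ 2 • t • fderiv ℝ f x (f x) + h ^ 3 • u))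
      =O[l] fun h => h ^ 4) :
    -- The first-order term cancels since `A f = J f`, and the linear part at `h ^ 2` since `A J f =
    -- J J f`. The zero is kept so that the statement fits `psi_apply_isBigO`.
    (fun h => Coeffs.remainder f A x (Y h) - (h • (0 : Vec N)
      + h ^ 2 • (s ^ 2 / 2) • fderiv ℝ (fderiv ℝ f) x (f x) (f x)
      + h ^ 3 • (fderiv ℝ f x u - A u
        + (s * t) • fderiv ℝ (fderiv ℝ f) x (f x) (fderiv ℝ f x (f x))
        + (s ^ 3 / 6) • iteratedFDeriv ℝ 3 f x fun _ => f x))) =O[l] fun h => h ^ 4 := by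
  have h1 := comp_isBigO_four (d := fun h => Y h - x) hf hl hY
  have h2 := (A.isBigO_comp _ l).trans hY
  have e3 : (iteratedFDeriv ℝ 3 f x fun _ => s • f x)
      = s ^ 3 • iteratedFDeriv ℝ 3 f x fun _ => f x := by
    simpa using (iteratedFDeriv ℝ 3 f x).map_smul_univ (fun _ => s) fun _ => f x
  refine (h1.sub h2).congr_left fun h => ?_
  simp only [Coeffs.remainder, add_sub_cancel, map_sub, map_add, map_smul, _root_.smul_apply, hA₁, hA₂, e3]
  module

variable (c : Coeffs)

theorem psi_zero_apply_isBigO (hl : l ≤ 𝓝 0)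
    (hA₁ : A (f x) = fderiv ℝ f x (f x))
    (hA₂ : A (fderiv ℝ f x (f x)) = fderiv ℝ f x (fderiv ℝ f x (f x))) (r : ℝ) :
    (fun h : ℝ => c.psi 0 ((r * h) • A) (h • f x) - (h • c.psiCoeff 0 0 • f x
      + h ^ 2 • (c.psiCoeff 0 1 * r) • fderiv ℝ f x (f x)
      + h ^ 3 • (c.psiCoeff 0 2 * r ^ 2) • fderiv ℝ f x (fderiv ℝ f x (f x)))) =O[l]
      fun h => h ^ 4 := by
  refine (((psi_apply_const_isBigO c 0 r A (f x) hl).trans (isBigO_pow_pow_of_le hl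
    (by norm_num : 4 ≤ 5))).add (isBigO_pow_smul hl (le_refl 4) (continuousAt_const
      (y := (c.psiCoeff 0 3 * r ^ 3) • A (A (A (f x))))))).congr_left fun h => ?_
  rw [hA₁, hA₂]
  module

theorem stage₁_isBigO (hl : l ≤ 𝓝 0)
    (hA₁ : A (f x) = fderiv ℝ f x (f x))
    (hA₂ : A (fderiv ℝ f x (f x)) = fderiv ℝ f x (fderiv ℝ f x (f x))) :
    (fun h => c.stage₁ f A x h - x - (h • (c.a 0 0 * c.psiCoeff 0 0) • f x
      + h ^ 2 • (c.a 0 0 * (c.psiCoeff 0 1 * c.g 0 0)) • fderiv ℝ f x (f x)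
      + h ^ 3 • (c.a 0 0 * (c.psiCoeff 0 2 * c.g 0 0 ^ 2)) •
        fderiv ℝ f x (fderiv ℝ f x (f x)))) =O[l] fun h => h ^ 4 := by
  refine ((psi_zero_apply_isBigO c hl hA₁ hA₂ (c.g 0 0)).const_smul_left (c.a 0 0)).congr_left
    fun h => ?_
  simp only [Coeffs.stage₁, Pi.smul_apply]
  module

theorem delta₁_isBigO (hf : ContDiffAt ℝ 4 f x) (hl : l ≤ 𝓝 0)
    (hA₁ : A (f x) = fderiv ℝ f x (f x))
    (hA₂ : A (fderiv ℝ f x (f x)) = fderiv ℝ f x (fderiv ℝ f x (f x))) {s t u : ℝ}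
    (hs : s = c.a 0 0 * c.psiCoeff 0 0) (ht : t = c.a 0 0 * (c.psiCoeff 0 1 * c.g 0 0))
    (hu : u = c.a 0 0 * (c.psiCoeff 0 2 * c.g 0 0 ^ 2)) :
    (fun h => c.delta₁ f A x h - (h • (0 : Vec N)
      + h ^ 2 • (s ^ 2 / 2) • fderiv ℝ (fderiv ℝ f) x (f x) (f x)
      + h ^ 3 • (u • (fderiv ℝ f x (fderiv ℝ f x (fderiv ℝ f x (f x)))
          - A (fderiv ℝ f x (fderiv ℝ f x (f x))))
        + (s * t) • fderiv ℝ (fderiv ℝ f) x (f x) (fderiv ℝ f x (f x))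
        + (s ^ 3 / 6) • iteratedFDeriv ℝ 3 f x fun _ => f x))) =O[l] fun h => h ^ 4 := by
  subst hs ht hu
  refine (remainder_isBigO hf hl hA₁ hA₂ (stage₁_isBigO c hl hA₁ hA₂)).congr_left fun h => ?_
  rw [Coeffs.delta₁, remainder_self, sub_zero, map_smul, map_smul, smul_sub]

theorem stage₂_isBigO (hf : ContDiffAt ℝ 4 f x) (hl : l ≤ 𝓝 0)
    (hA₁ : A (f x) = fderiv ℝ f x (f x))
    (hA₂ : A (fderiv ℝ f x (f x)) = fderiv ℝ f x (fderiv ℝ f x (f x))) {s : ℝ}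
    (hs : s = c.a 0 0 * c.psiCoeff 0 0) :
    (fun h => c.stage₂ f A x h - x - (h • (c.a 1 0 * c.psiCoeff 0 0) • f x
      + h ^ 2 • (c.a 1 0 * (c.psiCoeff 0 1 * c.g 1 0)) • fderiv ℝ f x (f x)
      + h ^ 3 • ((c.a 1 0 * (c.psiCoeff 0 2 * c.g 1 0 ^ 2)) • fderiv ℝ f x (fderiv ℝ f x (f x))
        + (c.a 1 1 * (c.psiCoeff 1 0 * (s ^ 2 / 2))) •
          fderiv ℝ (fderiv ℝ f) x (f x) (f x)))) =O[l] fun h => h ^ 4 := by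
  have h1 := (psi_zero_apply_isBigO c hl hA₁ hA₂ (c.g 1 0)).const_smul_left (c.a 1 0)
  have h2 := (psi_apply_isBigO c 1 (c.g 1 1) A hl
    (delta₁_isBigO c hf hl hA₁ hA₂ hs rfl rfl)).trans (isBigO_pow_pow_of_le hl
    (by norm_num : 4 ≤ 5))
  have h3 := isBigO_pow_smul hl (le_refl 4) (continuousAt_const
    (y := c.psiCoeff 1 0 • ((c.a 0 0 * (c.psiCoeff 0 2 * c.g 0 0 ^ 2)) •
          (fderiv ℝ f x (fderiv ℝ f x (fderiv ℝ f x (f x)))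
          - A (fderiv ℝ f x (fderiv ℝ f x (f x))))
        + (s * (c.a 0 0 * (c.psiCoeff 0 1 * c.g 0 0))) •
          fderiv ℝ (fderiv ℝ f) x (f x) (fderiv ℝ f x (f x))
        + (s ^ 3 / 6) • iteratedFDeriv ℝ 3 f x fun _ => f x)
      + (c.psiCoeff 1 1 * c.g 1 1 * (s ^ 2 / 2)) • A (fderiv ℝ (fderiv ℝ f) x (f x) (f x))))
  refine (h1.add ((h2.add h3).const_smul_left (c.a 1 1))).congr_left fun h => ?_
  simp only [Coeffs.stage₂, Pi.smul_apply, map_smul, map_zero]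
  module

/-- As `r` vanishes at `x`, the difference is `r(Y₂) - 2 r(Y₁)`. The number `w` is the weight of
`f''(f,f)` in `Y₂`; there `J` and `A` may disagree, which yields the separate trees `J f''(f,f)` and
`A f''(f,f)`. -/
theorem delta₂_isBigO (hf : ContDiffAt ℝ 4 f x) (hl : l ≤ 𝓝 0)
    (hA₁ : A (f x) = fderiv ℝ f x (f x))
    (hA₂ : A (fderiv ℝ f x (f x)) = fderiv ℝ f x (fderiv ℝ f x (f x))) {s t u s' t' u' w : ℝ}
    (hs : s = c.a 0 0 * c.psiCoeff 0 0) (ht : t = c.a 0 0 * (c.psiCoeff 0 1 * c.g 0 0))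
    (hu : u = c.a 0 0 * (c.psiCoeff 0 2 * c.g 0 0 ^ 2))
    (hs' : s' = c.a 1 0 * c.psiCoeff 0 0) (ht' : t' = c.a 1 0 * (c.psiCoeff 0 1 * c.g 1 0))
    (hu' : u' = c.a 1 0 * (c.psiCoeff 0 2 * c.g 1 0 ^ 2))
    (hw : w = c.a 1 1 * (c.psiCoeff 1 0 * (s ^ 2 / 2))) :
    (fun h => c.delta₂ f A x h - (h • (0 : Vec N)
      + h ^ 2 • ((s' ^ 2 - 2 * s ^ 2) / 2) • fderiv ℝ (fderiv ℝ f) x (f x) (f x)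
      + h ^ 3 • ((u' - 2 * u) • (fderiv ℝ f x (fderiv ℝ f x (fderiv ℝ f x (f x)))
          - A (fderiv ℝ f x (fderiv ℝ f x (f x))))
        + w • (fderiv ℝ f x (fderiv ℝ (fderiv ℝ f) x (f x) (f x))
          - A (fderiv ℝ (fderiv ℝ f) x (f x) (f x)))
        + (s' * t' - 2 * (s * t)) • fderiv ℝ (fderiv ℝ f) x (f x) (fderiv ℝ f x (f x))
        + ((s' ^ 3 - 2 * s ^ 3) / 6) • iteratedFDeriv ℝ 3 f x fun _ => f x))) =O[l]
      fun h => h ^ 4 := by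
  have h1 := delta₁_isBigO c hf hl hA₁ hA₂ hs ht hu
  have h2 := remainder_isBigO hf hl hA₁ hA₂ (stage₂_isBigO c hf hl hA₁ hA₂ hs)
  rw [← hs', ← ht', ← hu', ← hw] at h2
  refine (h2.sub (h1.const_smul_left (2 : ℝ))).congr_left fun h => ?_
  have e : c.delta₂ f A x h = Coeffs.remainder f A x (c.stage₂ f A x h)
      - (2 : ℝ) • c.delta₁ f A x h := by
    rw [Coeffs.delta₂, Coeffs.delta₁, remainder_self]
    module
  simp only [e, Pi.smul_apply, map_smul, map_add]
  module

theorem step_isBigO (hf : ContDiffAt ℝ 4 f x) (hl : l ≤ 𝓝 0)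
    (hA₁ : A (f x) = fderiv ℝ f x (f x))
    (hA₂ : A (fderiv ℝ f x (f x)) = fderiv ℝ f x (fderiv ℝ f x (f x))) {s t u s' t' u' w : ℝ}
    (hs : s = c.a 0 0 * c.psiCoeff 0 0) (ht : t = c.a 0 0 * (c.psiCoeff 0 1 * c.g 0 0))
    (hu : u = c.a 0 0 * (c.psiCoeff 0 2 * c.g 0 0 ^ 2))
    (hs' : s' = c.a 1 0 * c.psiCoeff 0 0) (ht' : t' = c.a 1 0 * (c.psiCoeff 0 1 * c.g 1 0))
    (hu' : u' = c.a 1 0 * (c.psiCoeff 0 2 * c.g 1 0 ^ 2))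
    (hw : w = c.a 1 1 * (c.psiCoeff 1 0 * (s ^ 2 / 2))) :
    (fun h => c.step f A x h - x - (h • (c.b 0 * c.psiCoeff 0 0) • f x
      + h ^ 2 • (c.b 0 * (c.psiCoeff 0 1 * c.g 2 0)) • fderiv ℝ f x (f x)
      + h ^ 3 • ((c.b 0 * (c.psiCoeff 0 2 * c.g 2 0 ^ 2)) • fderiv ℝ f x (fderiv ℝ f x (f x))
        + (c.b 1 * c.psiCoeff 1 0 * (s ^ 2 / 2)
          + c.b 2 * c.psiCoeff 2 0 * ((s' ^ 2 - 2 * s ^ 2) / 2)) •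
            fderiv ℝ (fderiv ℝ f) x (f x) (f x))
      + h ^ 4 • ((c.b 0 * (c.psiCoeff 0 3 * c.g 2 0 ^ 3)) •
          A (fderiv ℝ f x (fderiv ℝ f x (f x)))
        + (c.b 1 * c.psiCoeff 1 0 * u + c.b 2 * c.psiCoeff 2 0 * (u' - 2 * u)) •
          (fderiv ℝ f x (fderiv ℝ f x (fderiv ℝ f x (f x)))
            - A (fderiv ℝ f x (fderiv ℝ f x (f x))))
        + (c.b 2 * c.psiCoeff 2 0 * w) • fderiv ℝ f x (fderiv ℝ (fderiv ℝ f) x (f x) (f x))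
        + (c.b 1 * (c.psiCoeff 1 1 * c.g 2 1) * (s ^ 2 / 2)
            + c.b 2 * (c.psiCoeff 2 1 * c.g 2 2) * ((s' ^ 2 - 2 * s ^ 2) / 2)
            - c.b 2 * c.psiCoeff 2 0 * w) • A (fderiv ℝ (fderiv ℝ f) x (f x) (f x))
        + (c.b 1 * c.psiCoeff 1 0 * (s * t) + c.b 2 * c.psiCoeff 2 0 * (s' * t' - 2 * (s * t))) •
          fderiv ℝ (fderiv ℝ f) x (f x) (fderiv ℝ f x (f x))
        + (c.b 1 * c.psiCoeff 1 0 * (s ^ 3 / 6)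
            + c.b 2 * c.psiCoeff 2 0 * ((s' ^ 3 - 2 * s ^ 3) / 6)) •
          iteratedFDeriv ℝ 3 f x fun _ => f x))) =O[l] fun h => h ^ 5 := by
  have h0 := (psi_apply_const_isBigO c 0 (c.g 2 0) A (f x) hl).const_smul_left (c.b 0)
  have h1 := (psi_apply_isBigO c 1 (c.g 2 1) A hl
    (delta₁_isBigO c hf hl hA₁ hA₂ hs ht hu)).const_smul_left (c.b 1)
  have h2 := (psi_apply_isBigO c 2 (c.g 2 2) A hl
    (delta₂_isBigO c hf hl hA₁ hA₂ hs ht hu hs' ht' hu' hw)).const_smul_left (c.b 2)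
  refine ((h0.add h1).add h2).congr_left fun h => ?_
  simp only [Coeffs.step, Pi.smul_apply, map_smul, map_zero, hA₁, hA₂]
  module

end Step

/-! ### Local error, Krylov defect and order -/

section LocalError

variable (c : Coeffs)

theorem psiCoeff_zero (i : ℕ) : c.psiCoeff 0 i = c.p 0 0 / (i + 1).factorial := by
  have : Finset.univ.filter (fun k : Fin 3 => k ≤ 0) = {0} := by decide
  rw [Coeffs.psiCoeff, this]
  simp [div_eq_mul_inv]

theorem psiCoeff_one (i : ℕ) :
    c.psiCoeff 1 i = c.p 1 0 / (i + 1).factorial + c.p 1 1 / (i + 2).factorial := by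
  have : Finset.univ.filter (fun k : Fin 3 => k ≤ 1) = {0, 1} := by decide
  rw [Coeffs.psiCoeff, this]
  simp [div_eq_mul_inv]

theorem psiCoeff_two (i : ℕ) :
    c.psiCoeff 2 i = c.p 2 0 / (i + 1).factorial + c.p 2 1 / (i + 2).factorial
      + c.p 2 2 / (i + 3).factorial := by
  have : Finset.univ.filter (fun k : Fin 3 => k ≤ 2) = {0, 1, 2} := by decide
  rw [Coeffs.psiCoeff, this]
  simp [div_eq_mul_inv, add_assoc]

variable {N : ℕ} {f : Vec N → Vec N} {A : Vec N →L[ℝ] Vec N} {x : Vec N}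

theorem errorSeries_four (h : ℝ) : errorSeries c 4 f A x h =
    errorSeries c 3 f A x h + h ^ 4 •
      ((orderResidual c 4 / 6) • (iteratedFDeriv ℝ 3 f x fun _ => f x)
      + orderResidual c 5 • fderiv ℝ (fderiv ℝ f) x (f x) (fderiv ℝ f x (f x))
      + (orderResidual c 6 / 2) • fderiv ℝ f x (fderiv ℝ (fderiv ℝ f) x (f x) (f x))
      + (orderResidual c 7 / 2) • A (fderiv ℝ (fderiv ℝ f) x (f x) (f x))
      + orderResidual c 8 • fderiv ℝ f x (fderiv ℝ f x (fderiv ℝ f x (f x)))) := by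
  have h4 : Finset.univ.filter (fun i : Fin 9 => treeOrder i ≤ 4) = Finset.univ := by decide
  have h3 : Finset.univ.filter (fun i : Fin 9 => treeOrder i ≤ 3) = {0, 1, 2, 3} := by decide
  have e : (![f x, f x, f x] : Fin 3 → Vec N) = fun _ => f x := by
    ext1 i; fin_cases i <;> rfl
  rw [errorSeries, errorSeries, h4, h3]
  simp [Fin.sum_univ_succ, treeOrder, symmetry, elementaryDifferential, e,
    iteratedFDeriv_two_apply]
  module

theorem errorSeries_three (h : ℝ) : errorSeries c 3 f A x h =
    h • orderResidual c 0 • f x + h ^ 2 • orderResidual c 1 • fderiv ℝ f x (f x)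
      + h ^ 3 • ((orderResidual c 2 / 2) • fderiv ℝ (fderiv ℝ f) x (f x) (f x)
        + orderResidual c 3 • fderiv ℝ f x (fderiv ℝ f x (f x))) := by
  have h3 : Finset.univ.filter (fun i : Fin 9 => treeOrder i ≤ 3) = {0, 1, 2, 3} := by decide
  rw [errorSeries, h3]
  simp [treeOrder, symmetry, elementaryDifferential, iteratedFDeriv_two_apply]
  module

/-- The local error of one step. The matrix `A` only has to agree with the Jacobian on `f x` and
`J (f x)`; the defect on `J (J (f x))` enters at order four. -/
theorem local_error_isBigO (hf : ContDiffAt ℝ 4 f x)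
    (hA₁ : A (f x) = fderiv ℝ f x (f x))
    (hA₂ : A (fderiv ℝ f x (f x)) = fderiv ℝ f x (fderiv ℝ f x (f x)))
    {d : ℝ → Vec N} {T : ℝ} (hT : 0 < T)
    (hd : ∀ t ∈ Icc 0 T, HasDerivWithinAt d (f (x + d t)) (Icc 0 T) t) (hd0 : d 0 = 0) :
    ∃ k : ℝ, (fun h => c.step f A x h - (x + d h) - errorSeries c 4 f A x h
      - h ^ 4 • k • (fderiv ℝ f x (fderiv ℝ f x (fderiv ℝ f x (f x)))
          - A (fderiv ℝ f x (fderiv ℝ f x (f x))))) =O[𝓝[≥] 0] fun h => h ^ 5 := by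
  have h1 := step_isBigO c (l := 𝓝[≥] 0) hf nhdsWithin_le_nhds hA₁ hA₂ rfl rfl rfl rfl rfl rfl rfl
  have h2 := exact_increment_isBigO hf hT hd hd0
  -- The positive part is the weight of `J^3 f - A J^2 f` in the step. The last term comes from
  -- rewriting `A J^2 f` as `J^3 f` minus the defect, because the error series contains `J^3 f`.
  refine ⟨c.b 1 * c.psiCoeff 1 0 * (c.a 0 0 * (c.psiCoeff 0 2 * c.g 0 0 ^ 2))
    + c.b 2 * c.psiCoeff 2 0 * (c.a 1 0 * (c.psiCoeff 0 2 * c.g 1 0 ^ 2)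
      - 2 * (c.a 0 0 * (c.psiCoeff 0 2 * c.g 0 0 ^ 2)))
    - c.b 0 * (c.psiCoeff 0 3 * c.g 2 0 ^ 3), (h1.sub h2).congr_left fun h => ?_⟩
  rw [errorSeries_four, errorSeries_three]
  simp [psiCoeff_zero, psiCoeff_one, psiCoeff_two, Nat.factorial, orderResidual]
  match_scalars <;> field_simp <;> ring

theorem local_error_krylov {U : Set (Vec N)} (hU : IsOpen U) (hf : ContDiffOn ℝ ∞ f U)
    {t₀ tF : ℝ} {y : ℝ → Vec N} (ht : t₀ < tF)
    (hy : ∀ t ∈ Icc t₀ tF, y t ∈ U ∧ HasDerivWithinAt y (f (y t)) (Icc t₀ tF) t)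
    {M m : ℕ} {V : Vec m →ₗᵢ[ℝ] Vec N} (hM : 3 ≤ M)
    (hV : LinearMap.range V.toLinearMap = krylov (fderiv ℝ f (y t₀)) (f (y t₀)) M) :
    ∃ k : ℝ, (fun h => c.step f (projectedJacobian (fderiv ℝ f (y t₀)) V) (y t₀) h - y (t₀ + h)
        - errorSeries c 4 f (projectedJacobian (fderiv ℝ f (y t₀)) V) (y t₀) h
      - h ^ 4 • k • ((fderiv ℝ f (y t₀) ^ 3) (f (y t₀)) -
          projectedJacobian (fderiv ℝ f (y t₀)) V ((fderiv ℝ f (y t₀) ^ 2) (f (y t₀)))))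
      =O[𝓝[≥] 0] fun h => h ^ 5 := by
  have hmem : t₀ ∈ Icc t₀ tF := left_mem_Icc.2 ht.le
  have hf4 : ContDiffAt ℝ 4 f (y t₀) :=
    (hf.contDiffAt (hU.mem_nhds (hy t₀ hmem).1)).of_le (WithTop.coe_le_coe.2 (le_top : (4 : ℕ∞) ≤ ⊤))
  have hp := fun i hi => projectedJacobian_apply_pow (fderiv ℝ f (y t₀)) V (i := i) hV hi
  obtain ⟨k, hk⟩ := local_error_isBigO c (A := projectedJacobian (fderiv ℝ f (y t₀)) V) hf4
    (by simpa using hp 0 (by omega))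
    (by simpa [pow_succ'] using hp 1 (by omega))
    (d := fun h => y (t₀ + h) - y t₀) (T := tF - t₀) (sub_pos.2 ht)
    (fun t ht' => by
      have hmaps : MapsTo (fun h => t₀ + h) (Icc 0 (tF - t₀)) (Icc t₀ tF) := fun h hh =>
        ⟨by linarith [hh.1], by linarith [hh.2]⟩
      have h1 : HasDerivWithinAt (fun h : ℝ => t₀ + h) 1 (Icc 0 (tF - t₀)) t :=
        (hasDerivWithinAt_id t _).const_add t₀
      have h2 := (hy (t₀ + t) (hmaps ht')).2.scomp t h1 hmaps
      simpa [Function.comp_def] using h2.sub_const (y t₀))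
    (by simp)
  refine ⟨k, hk.congr_left fun h => ?_⟩
  simp [pow_succ']

theorem hasErrorExpansionK_four : HasErrorExpansionK c 4 := by
  intro N U f hU hf t₀ tF y ht hy M m V hM hV
  obtain ⟨k, hk⟩ := local_error_krylov c hU hf ht hy (by omega) hV
  refine (hk.mono (nhdsWithin_mono _ Ioi_subset_Ici_self)).congr_left fun h => ?_
  rw [projectedJacobian_apply_pow _ V hV (by omega), sub_self, smul_zero, smul_zero, sub_zero]

/-- With `M = 3` the defect need not vanish, but it and the fourth-order trees together form `h ^ 4`
times a fixed vector. -/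
theorem hasErrorExpansionK_three : HasErrorExpansionK c 3 := by
  intro N U f hU hf t₀ tF y ht hy M m V hM hV
  obtain ⟨k, hk⟩ := local_error_krylov c hU hf ht hy hM hV
  have hl : 𝓝[>] (0 : ℝ) ≤ 𝓝 0 := nhdsWithin_le_nhds
  have h1 := (hk.mono (nhdsWithin_mono _ Ioi_subset_Ici_self)).trans
    (isBigO_pow_pow_of_le hl (by norm_num : 4 ≤ 5))
  obtain ⟨w, hw⟩ : ∃ w, ∀ h, errorSeries c 4 f (projectedJacobian (fderiv ℝ f (y t₀)) V) (y t₀) h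
      = errorSeries c 3 f (projectedJacobian (fderiv ℝ f (y t₀)) V) (y t₀) h + h ^ 4 • w :=
    ⟨_, errorSeries_four c⟩
  refine (h1.add (isBigO_pow_smul hl (le_refl 4) (continuousAt_const
    (y := w + k • ((fderiv ℝ f (y t₀) ^ 3) (f (y t₀)) - projectedJacobian (fderiv ℝ f (y t₀)) V
      ((fderiv ℝ f (y t₀) ^ 2) (f (y t₀)))))))).congr_left fun h => ?_
  rw [smul_add, hw]
  abel

theorem hasOrderK_of_hasErrorExpansionK {q : ℕ} (hc : SatisfiesTK c q)
    (h : HasErrorExpansionK c q) : HasOrderK c q := by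
  intro N U f hU hf t₀ tF y ht hy M m V hM hV
  refine (h N U f hU hf t₀ tF y ht hy M m V hM hV).congr_left fun h => ?_
  have : errorSeries c q f (projectedJacobian (fderiv ℝ f (y t₀)) V) (y t₀) h = 0 :=
    Finset.sum_eq_zero fun i hi => by rw [hc i (Finset.mem_filter.1 hi).2, zero_mul, zero_smul]
  rw [this, sub_zero]

end LocalError

/-! ### Residuals of the concrete coefficients -/

section Coefficients

/-- Here `b₁ p₁₁ = 1` and `a₁₁ p₁₁ = a₂₁ p₁₁ = α^2`, so `α` enters only through the square and the
cube of `α^2`. -/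
theorem orderResidual_epirkk4 {α : ℝ} (hα : α ≠ 0) :
    orderResidual (epirkk4 α) = ![0, 0, 16 / 27 * (α ^ 4 - 9 / 16), 0,
      16 / 27 * (α ^ 6 - 27 / 64), 2 / 9 * (α ^ 4 - 9 / 16), 4 / 27 * (α ^ 4 - 9 / 16), 0, 0] := by
  ext i
  fin_cases i <;> simp [orderResidual, epirkk4, hα] <;> ring

theorem orderResidual_epirkk4Embedded {α : ℝ} (hα : α ≠ 0) (i : Fin 9) (hi : treeOrder i ≤ 3) :
    orderResidual (epirkk4Embedded α) i = if i = 2 then 16 / 27 * (α ^ 4 - 9 / 16) else 0 := by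
  fin_cases i <;> simp [treeOrder] at hi <;>
    simp [orderResidual, epirkk4Embedded, epirkk4, hα]
  ring

theorem sqrt_three_half_sq : (√3 / 2 : ℝ) ^ 2 = 3 / 4 := by
  rw [div_pow, Real.sq_sqrt (by norm_num)]
  norm_num

theorem satisfiesTK_epirkk4 : SatisfiesTK (epirkk4 (√3 / 2)) 4 := by
  have h4 : (√3 / 2 : ℝ) ^ 4 = 9 / 16 := by
    rw [show 4 = 2 * 2 from rfl, pow_mul, sqrt_three_half_sq]; norm_num
  have h6 : (√3 / 2 : ℝ) ^ 6 = 27 / 64 := by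
    rw [show 6 = 2 * 3 from rfl, pow_mul, sqrt_three_half_sq]; norm_num
  intro i _
  rw [orderResidual_epirkk4 (by positivity), h4, h6]
  fin_cases i <;> simp

theorem satisfiesTK_epirkk4Embedded : SatisfiesTK (epirkk4Embedded (√3 / 2)) 3 := by
  have h4 : (√3 / 2 : ℝ) ^ 4 = 9 / 16 := by
    rw [show 4 = 2 * 2 from rfl, pow_mul, sqrt_three_half_sq]; norm_num
  intro i hi
  rw [orderResidual_epirkk4Embedded (by positivity) i hi, h4]
  simp

theorem abs_printedAlpha_sub_lt : |printedAlpha - √3 / 2| < 1 / 10 ^ 30 := by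
  -- Squaring turns both bounds on `√3` into comparisons of rationals with `3`.
  have h1 : 2 * printedAlpha - 2 / 10 ^ 30 < √3 :=
    Real.lt_sqrt_of_sq_lt (by norm_num [printedAlpha])
  have h2 : √3 < 2 * printedAlpha + 2 / 10 ^ 30 :=
    (Real.sqrt_lt' (by norm_num [printedAlpha])).2 (by norm_num [printedAlpha])
  rw [abs_lt]
  constructor <;> linarith

theorem abs_orderResidual_epirkk4_printedAlpha_lt (i : Fin 9) :
    |orderResidual (epirkk4 printedAlpha) i| < 1 / 10 ^ 30 := by
  rw [orderResidual_epirkk4 (by norm_num [printedAlpha]), abs_lt]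
  fin_cases i <;> norm_num [printedAlpha]

theorem abs_orderResidual_epirkk4Embedded_printedAlpha_lt (i : Fin 9) (hi : treeOrder i ≤ 3) :
    |orderResidual (epirkk4Embedded printedAlpha) i| < 1 / 10 ^ 30 := by
  rw [orderResidual_epirkk4Embedded (by norm_num [printedAlpha]) i hi, abs_lt]
  split_ifs <;> norm_num [printedAlpha]

end Coefficients

end EPIRK

theorem mainTheorem7 :
    -- the exact coefficients, with `α = √3 / 2`
    (EPIRK.SatisfiesTK (EPIRK.epirkk4 (√3 / 2)) 4
      ∧ EPIRK.HasOrderK (EPIRK.epirkk4 (√3 / 2)) 4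
      ∧ EPIRK.SatisfiesTK (EPIRK.epirkk4Embedded (√3 / 2)) 3
      ∧ EPIRK.HasOrderK (EPIRK.epirkk4Embedded (√3 / 2)) 3)
    -- the printed rational coefficients: a rounding of the exact ones, for which the order
    -- conditions hold up to the rounding error, and with them the order
    ∧ |EPIRK.printedAlpha - √3 / 2| < 1 / 10 ^ 30
    ∧ ((∀ i, |EPIRK.orderResidual (EPIRK.epirkk4 EPIRK.printedAlpha) i| < 1 / 10 ^ 30)
      ∧ EPIRK.HasErrorExpansionK (EPIRK.epirkk4 EPIRK.printedAlpha) 4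
      ∧ (∀ i, EPIRK.treeOrder i ≤ 3 →
          |EPIRK.orderResidual (EPIRK.epirkk4Embedded EPIRK.printedAlpha) i| < 1 / 10 ^ 30)
      ∧ EPIRK.HasErrorExpansionK (EPIRK.epirkk4Embedded EPIRK.printedAlpha) 3) :=
  ⟨⟨EPIRK.satisfiesTK_epirkk4,
    EPIRK.hasOrderK_of_hasErrorExpansionK _ EPIRK.satisfiesTK_epirkk4
      (EPIRK.hasErrorExpansionK_four _),
    EPIRK.satisfiesTK_epirkk4Embedded,
    EPIRK.hasOrderK_of_hasErrorExpansionK _ EPIRK.satisfiesTK_epirkk4Embedded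
      (EPIRK.hasErrorExpansionK_three _)⟩,
    EPIRK.abs_printedAlpha_sub_lt,
    EPIRK.abs_orderResidual_epirkk4_printedAlpha_lt,
    EPIRK.hasErrorExpansionK_four _,
    EPIRK.abs_orderResidual_epirkk4Embedded_printedAlpha_lt,
    EPIRK.hasErrorExpansionK_three _⟩
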